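/- For every infinite cardinal $\kappa$ there is a graph $G$ that admits a $\lambda$-decomposition for every cardinal $\lambda$ with $2\le\lambda\le\kappa$, that is, for every such $\lambda$ there are $\lambda$ many spanning trees of $G$ whose edge sets partition the edge set of $G$. Moreover, $G$ can be taken to be the following graph: let $G_0=K_2$ be the complete graph on two vertices; for each $n\in\mathbb N$ let $G_{n+1}$ be obtained from $G_n$ by adding, for every pair of distinct vertices $u,v$ of $G_n$, $\kappa$ many new $u$–$v$ paths of length two, all of them internally disjoint from each other and from $G_n$; and let $G=\bigcup_{n\in\mathbb N}G_n$. This simple graph $G$ has colouring number exactly $3$ and edge-connectivity exactly $\kappa$. Here the colouring number of a simple graph is the smallest cardinal $\mu$ for which there is a well-ordering of the vertex set such that every vertex $v$ has fewer than $\mu$ neighbours preceding $v$ in the ordering, and the edge-connectivity of a graph with at least two vertices is the smallest cardinality of a set of edges whose deletion leaves a disconnected graph. -/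

import Mathlib

open Cardinal

universe u

/-- A spanning tree of `G`: a connected, acyclic subgraph containing all vertices of `G`. -/
def IsSpanningTree {V : Type u} (G T : SimpleGraph V) : Prop :=
  T ≤ G ∧ T.IsTree

/-- `G` admits a `μ`-decomposition: there are `μ` many spanning trees of `G` whose edge sets
partition the edge set of `G`. -/
def HasDecomposition {V : Type u} (G : SimpleGraph V) (μ : Cardinal.{u}) : Prop :=
  ∃ (ι : Type u) (T : ι → SimpleGraph V), #ι = μ ∧
    (∀ i, IsSpanningTree G (T i)) ∧
    (∀ i j, i ≠ j → Disjoint (T i).edgeSet (T j).edgeSet) ∧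
    ⋃ i, (T i).edgeSet = G.edgeSet

/-- The colouring number: the smallest cardinal `μ` such that some well-ordering `r` of the
vertices has, for every vertex `v`, fewer than `μ` edges between `v` and the `r`-smaller vertices.
(The graph is simple, so these edges are counted by their `r`-smaller endvertices. The set below
contains the successor of `#V`, so the infimum is a minimum.) -/
noncomputable def colouringNumber {V : Type u} (G : SimpleGraph V) : Cardinal.{u} :=
  sInf {μ : Cardinal.{u} | ∃ r : V → V → Prop, IsWellOrder V r ∧
    ∀ v : V, #{w : V // r w v ∧ G.Adj v w} < μ}

/-- The edge-connectivity of a graph with at least two vertices: the smallest cardinality of a set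
of edges whose deletion leaves a disconnected graph. -/
noncomputable def edgeConnectivity {V : Type u} (G : SimpleGraph V) : Cardinal.{u} :=
  sInf {μ : Cardinal.{u} | ∃ F : Set (Sym2 V), F ⊆ G.edgeSet ∧
    ¬ (G.deleteEdges F).Connected ∧ #F = μ}

/-- The unordered pairs of distinct elements of `S`. -/
abbrev DistinctPairs {V : Type u} (S : Set V) : Type u :=
  {e : Sym2 V // ¬ e.IsDiag ∧ ∀ x ∈ e, x ∈ S}

/-- `H'` arises from `H` by adding, for every two distinct vertices `x`, `y` of `H`, exactly `κ`
many new paths `x, m, y` of length two; the middle vertices `m` are pairwise distinct and are not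
vertices of `H`, and nothing else is added. -/
def IsTwoPathExtension {V : Type u} {G : SimpleGraph V} (κ : Cardinal.{u})
    (H H' : G.Subgraph) : Prop :=
  ∃ m : DistinctPairs H.verts × κ.out → V,
    Function.Injective m ∧
    (∀ p, m p ∉ H.verts) ∧
    H'.verts = H.verts ∪ Set.range m ∧
    ∀ a b : V, H'.Adj a b ↔
      H.Adj a b ∨ (∃ p, a = m p ∧ b ∈ p.1.1) ∨ (∃ p, b = m p ∧ a ∈ p.1.1)

/-- `G` is the union of a sequence of graphs `H 0, H 1, …`, where `H 0` is a complete graph on two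
vertices and `H (n + 1)` arises from `H n` by adding `κ` many new paths of length two between any
two distinct vertices of `H n`. (This determines `G` up to isomorphism.) -/
def IsIteratedTwoPathGraph {V : Type u} (κ : Cardinal.{u}) (G : SimpleGraph V) : Prop :=
  ∃ H : ℕ → G.Subgraph,
    (∃ x y : V, x ≠ y ∧ (H 0).verts = {x, y} ∧ (H 0).Adj x y) ∧
    (∀ n, IsTwoPathExtension κ (H n) (H (n + 1))) ∧
    ⨆ n, H n = ⊤

/-! Orient each edge down to the vertex that was present earlier. Every vertex then has at most two
downward edges, and for a fixed root `a`, every `w ≠ a` and every colour `i` there is a private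
vertex `s w i` attached to exactly `a` and `w`. Colour the downward edges by recursion on the level.
If no downward edge at `w` has colour `i`, both edges at `s w i` get colour `i`, and this connector
joins `w` to `a`; every other vertex gives its downward edges distinct colours. In each colour class
every vertex other than `a` has a unique parent: a connector has `a`, a vertex with a downward edge
of that colour has its lower end, and any other vertex has its connector. So each class is a
spanning tree (`hasDecomposition_of_downward`), and two colours suffice for the recursion. The
downward degrees and a triangle give colouring number 3. For edge-connectivity, any two distinct
vertices are joined by `κ` disjoint paths, and there are only `κ` edges. -/

/-! ### Spanning trees from a colouring of downward edges -/

/-- A graph whose edges join each vertex other than `r` to its unique parent, where parents have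
smaller rank, is a tree. -/
theorem isTree_of_parent {V : Type u} (T : SimpleGraph V) (r : V) (P : V → V → Prop)
    (rank : V → ℕ) (hadj : ∀ x y, T.Adj x y ↔ P x y ∨ P y x)
    (hrank : ∀ x y, P x y → rank y < rank x) (hr : ∀ y, ¬ P r y)
    (hex : ∀ x, x ≠ r → ∃ y, P x y) (huniq : ∀ x y z, P x y → P x z → y = z) : T.IsTree := by
  have hreach : ∀ n x, rank x = n → T.Reachable x r := by
    intro n
    induction n using Nat.strong_induction_on with
    | _ n ih =>
      intro x hx
      by_cases hxr : x = r
      · subst hxr; exact SimpleGraph.Reachable.refl _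
      · obtain ⟨y, hy⟩ := hex x hxr
        have h1 : T.Adj x y := (hadj x y).2 (Or.inl hy)
        exact h1.reachable.trans (ih _ (hx ▸ hrank x y hy) y rfl)
  have hbridge : ∀ v w, P v w → ¬ (T \ SimpleGraph.fromEdgeSet {s(v, w)}).Reachable v w := by
    intro v w hvw hre
    -- The descendants of `v` are closed under the edges other than `vw`; by rank, `w` is not among
    -- them.
    have key : ∀ x y, (T \ SimpleGraph.fromEdgeSet {s(v, w)}).Reachable x y →
        Relation.ReflTransGen P x v → Relation.ReflTransGen P y v := by
      rintro x y ⟨p⟩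
      induction p with
      | nil => exact id
      | @cons x y z hxy _ ih =>
        intro hx
        refine ih ?_
        rw [SimpleGraph.sdiff_adj, SimpleGraph.fromEdgeSet_adj, hadj] at hxy
        obtain ⟨h1, h2⟩ := hxy
        rcases h1 with h1 | h1
        · rcases hx.cases_head with rfl | ⟨c, hc, hcv⟩
          · exfalso
            have := huniq _ _ _ h1 hvw
            subst this
            refine h2 ⟨rfl, fun h => ?_⟩
            have := hrank _ _ h1
            rw [h] at this
            exact lt_irrefl _ this
          · rw [huniq _ _ _ h1 hc]; exact hcv
        · exact Relation.ReflTransGen.head h1 hx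
    have hle : ∀ x, Relation.ReflTransGen P x v → rank v ≤ rank x := by
      intro x hx
      induction hx using Relation.ReflTransGen.head_induction_on with
      | refl => exact le_rfl
      | head h _ ih => exact ih.trans (hrank _ _ h).le
    exact absurd (hle w (key v w hre Relation.ReflTransGen.refl)) (not_le.2 (hrank _ _ hvw))
  have : Nonempty V := ⟨r⟩
  refine ⟨⟨fun x y => (hreach _ x rfl).trans (hreach _ y rfl).symm⟩, ?_⟩
  rw [SimpleGraph.isAcyclic_iff_forall_adj_isBridge]
  intro v w hvw
  rw [SimpleGraph.isBridge_iff]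
  rcases (hadj v w).1 hvw with h | h
  · exact hbridge v w h
  · rw [Sym2.eq_swap]
    exact fun h' => hbridge w v h h'.symm

/-- A colouring of the downward edges for which both edges at `s w i` receive the colour `i` if no
downward edge at `w` does, and for which the downward edges at any other vertex have distinct
colours. -/
theorem exists_downward_colouring {V ι : Type u} (D : V → V → Prop) (lev : V → ℕ) (a : V)
    (s : V → ι → V) (hslev : ∀ w i, w ≠ a → lev w < lev (s w i))
    (hinj : ∀ w w' i i', w ≠ a → w' ≠ a → s w i = s w' i' → w = w' ∧ i = i')
    (fst : V → V) (hfst : ∀ v x y, D v x → D v y → x ≠ fst v → y ≠ fst v → x = y)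
    {i₀ i₁ : ι} (hi : i₀ ≠ i₁) :
    ∃ col : V → V → ι,
      (∀ w i, w ≠ a → (∀ x, D w x → col w x ≠ i) → ∀ x, col (s w i) x = i) ∧
      ∀ v, (∃ w i, w ≠ a ∧ v = s w i ∧ ∀ x, D w x → col w x ≠ i) ∨
        ∀ x y, D v x → D v y → col v x = col v y → x = y := by
  classical
  -- The condition `hlt` only licenses the recursive call; `hslev` supplies it for every `s w i`.
  let F : ∀ v : V, (∀ w : V, lev w < lev v → V → ι) → V → ι := fun v rec x =>
    if h : ∃ p : V × ι, ∃ hlt : lev p.1 < lev v, p.1 ≠ a ∧ v = s p.1 p.2 ∧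
      ∀ y, D p.1 y → rec p.1 hlt y ≠ p.2 then h.choose.2 else if x = fst v then i₀ else i₁
  have wf : WellFounded (fun w v : V => lev w < lev v) := InvImage.wf lev wellFounded_lt
  let col : V → V → ι := wf.fix F
  have hcol : ∀ v x, col v x = if h : ∃ p : V × ι, ∃ _ : lev p.1 < lev v, p.1 ≠ a ∧
      v = s p.1 p.2 ∧ ∀ y, D p.1 y → col p.1 y ≠ p.2 then h.choose.2
      else if x = fst v then i₀ else i₁ := by
    intro v x
    exact congrFun (wf.fix_eq F v) x
  refine ⟨col, ?_, ?_⟩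
  · intro w i hw hmiss x
    have h : ∃ p : V × ι, ∃ _ : lev p.1 < lev (s w i), p.1 ≠ a ∧
        s w i = s p.1 p.2 ∧ ∀ y, D p.1 y → col p.1 y ≠ p.2 :=
      ⟨(w, i), hslev w i hw, hw, rfl, hmiss⟩
    rw [hcol, dif_pos h]
    obtain ⟨_, h1, h2, _⟩ := h.choose_spec
    exact (hinj _ _ _ _ hw h1 h2).2.symm
  · intro v
    by_cases h : ∃ p : V × ι, ∃ _ : lev p.1 < lev v, p.1 ≠ a ∧
        v = s p.1 p.2 ∧ ∀ y, D p.1 y → col p.1 y ≠ p.2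
    · obtain ⟨p, _, h1, h2, h3⟩ := h
      exact Or.inl ⟨p.1, p.2, h1, h2, h3⟩
    · right
      intro x y hx hy hxy
      rw [hcol, hcol, dif_neg h, dif_neg h] at hxy
      by_cases hx1 : x = fst v <;> by_cases hy1 : y = fst v
      · rw [hx1, hy1]
      · simp [hx1, hy1, hi] at hxy
      · simp [hx1, hy1, hi.symm] at hxy
      · exact hfst v x y hx hy hx1 hy1

/-- A graph with at most two downward edges at every vertex decomposes into spanning trees indexed
by `ι` if every vertex `w ≠ a` has, for each `i : ι`, a private common upper neighbour `s w i` with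
`a`. -/
theorem hasDecomposition_of_downward {V ι : Type u} (G : SimpleGraph V) (D : V → V → Prop)
    (hG : ∀ x y, G.Adj x y ↔ D x y ∨ D y x) (lev : V → ℕ)
    (hlev : ∀ v w, D v w → lev w < lev v) (a : V) (ha : ∀ w, ¬ D a w)
    (s : V → ι → V) (hs : ∀ w i, w ≠ a → ∀ x, D (s w i) x ↔ x = a ∨ x = w)
    (hinj : ∀ w w' i i', w ≠ a → w' ≠ a → s w i = s w' i' → w = w' ∧ i = i')
    (fst : V → V) (hfst : ∀ v x y, D v x → D v y → x ≠ fst v → y ≠ fst v → x = y)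
    {i₀ i₁ : ι} (hi : i₀ ≠ i₁) : HasDecomposition G #ι := by
  classical
  obtain ⟨col, hspec, hdist⟩ := exists_downward_colouring D lev a s
    (fun w i hw => hlev _ _ ((hs w i hw w).2 (Or.inr rfl))) hinj fst hfst hi
  let T : ι → SimpleGraph V := fun i =>
    { Adj := fun x y => (D x y ∧ col x y = i) ∨ (D y x ∧ col y x = i)
      symm := ⟨fun x y h => h.symm⟩
      loopless := ⟨fun x h => by
        rcases h with h | h <;> exact lt_irrefl _ (hlev _ _ h.1)⟩ }
  refine ⟨ι, T, rfl, ?_, ?_, ?_⟩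
  · intro i
    refine ⟨?_, ?_⟩
    · intro x y h
      rw [hG]
      exact h.imp And.left And.left
    -- `Sp v w` says that `v` is the connector of `w` in colour `i`.
    let Sp : V → V → Prop := fun v w => w ≠ a ∧ v = s w i ∧ ∀ x, D w x → col w x ≠ i
    have hSpcol : ∀ v w, Sp v w → ∀ x, col v x = i := by
      rintro v w ⟨h1, rfl, h3⟩ x
      exact hspec w i h1 h3 x
    have hSpD : ∀ v w, Sp v w → ∀ x, D v x ↔ x = a ∨ x = w := by
      rintro v w ⟨h1, rfl, -⟩ x
      exact hs w i h1 x
    have hSpuniq : ∀ v x y, ¬ (∃ w, Sp v w) → D v x → D v y → col v x = i → col v y = i →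
        x = y := by
      intro v x y hv hx hy hcx hcy
      rcases hdist v with ⟨w, j, h1, rfl, h3⟩ | h
      · have hj : j = i := (hspec w j h1 h3 x).symm.trans hcx
        subst hj
        exact absurd ⟨w, h1, rfl, h3⟩ hv
      · exact h x y hx hy (hcx.trans hcy.symm)
    -- A connector has a downward edge of colour `i`, so it never needs a connector itself.
    have hnotSp : ∀ v w, Sp v w → ¬ ∃ x, Sp w x := by
      rintro v w ⟨_, _, h⟩ ⟨x, hx⟩
      exact h a ((hSpD w x hx a).2 (Or.inl rfl)) (hSpcol w x hx a)
    refine isTree_of_parent (T i) a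
      (fun v w => ((∃ x, Sp v x) ∧ w = a) ∨ ((¬ ∃ x, Sp v x) ∧ D v w ∧ col v w = i) ∨ Sp w v)
      -- Parents can lie above their children in level, so connectors are ranked just above the root
      -- and below all other vertices.
      (fun v => if v = a then 0 else if ∃ x, Sp v x then 1 else lev v + 2) ?_ ?_ ?_ ?_ ?_
    · have hforward : ∀ x y, D x y → col x y = i →
          (((∃ z, Sp x z) ∧ y = a) ∨ ((¬ ∃ z, Sp x z) ∧ D x y ∧ col x y = i) ∨ Sp y x) ∨
          (((∃ z, Sp y z) ∧ x = a) ∨ ((¬ ∃ z, Sp y z) ∧ D y x ∧ col y x = i) ∨ Sp x y) := by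
        intro x y h hc
        by_cases hx : ∃ z, Sp x z
        · obtain ⟨z, hz⟩ := hx
          rcases (hSpD x z hz y).1 h with rfl | rfl
          · exact Or.inl (Or.inl ⟨⟨z, hz⟩, rfl⟩)
          · exact Or.inr (Or.inr (Or.inr hz))
        · exact Or.inl (Or.inr (Or.inl ⟨hx, h, hc⟩))
      have hback : ∀ x y,
          (((∃ z, Sp x z) ∧ y = a) ∨ ((¬ ∃ z, Sp x z) ∧ D x y ∧ col x y = i) ∨ Sp y x) →
          (T i).Adj x y := by
        rintro x y (⟨⟨z, hz⟩, rfl⟩ | ⟨_, h⟩ | h)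
        · exact Or.inl ⟨(hSpD x z hz y).2 (Or.inl rfl), hSpcol x z hz y⟩
        · exact Or.inl h
        · exact Or.inr ⟨(hSpD y x h x).2 (Or.inr rfl), hSpcol y x h x⟩
      intro x y
      constructor
      · rintro (⟨h, hc⟩ | ⟨h, hc⟩)
        · exact hforward x y h hc
        · exact (hforward y x h hc).symm
      · rintro (h | h)
        · exact hback x y h
        · exact (hback y x h).symm
    · have hSpa : ∀ v w, Sp v w → v ≠ a := by
        rintro v w hv rfl
        exact ha v ((hSpD v w hv v).2 (Or.inl rfl))
      rintro v w (⟨⟨z, hz⟩, rfl⟩ | ⟨hz, h, hc⟩ | h)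
      · simp only [hSpa v z hz, if_true, if_false, if_pos (⟨z, hz⟩ : ∃ x, Sp v x)]
        exact Nat.one_pos
      · have hva : v ≠ a := by rintro rfl; exact ha _ h
        have := hlev _ _ h
        simp only [if_neg hva, if_neg hz]
        split_ifs <;> omega
      · simp only [if_neg h.1, if_neg (hnotSp _ _ h), if_neg (hSpa w v h),
          if_pos (⟨v, h⟩ : ∃ x, Sp w x)]
        omega
    · rintro w (⟨⟨z, hz⟩, rfl⟩ | ⟨_, h, _⟩ | h)
      · exact ha w ((hSpD w z hz w).2 (Or.inl rfl))
      · exact ha _ h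
      · exact h.1 rfl
    · intro v hv
      by_cases h : ∃ x, Sp v x
      · exact ⟨a, Or.inl ⟨h, rfl⟩⟩
      · by_cases h' : ∃ w, D v w ∧ col v w = i
        · obtain ⟨w, hw⟩ := h'
          exact ⟨w, Or.inr (Or.inl ⟨h, hw⟩)⟩
        · exact ⟨s v i, Or.inr (Or.inr ⟨hv, rfl, fun x hx hc => h' ⟨x, hx, hc⟩⟩)⟩
    · rintro v w w' (⟨hz, rfl⟩ | ⟨hz, h, hc⟩ | h) (⟨hz', rfl⟩ | ⟨hz', h', hc'⟩ | h')
      · rfl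
      · exact absurd hz hz'
      · exact absurd hz (hnotSp _ _ h')
      · exact absurd hz' hz
      · exact hSpuniq v w w' hz h h' hc hc'
      · exact absurd hc (h'.2.2 _ h)
      · exact absurd hz' (hnotSp _ _ h)
      · exact absurd hc' (h.2.2 _ h')
      · exact h.2.1.trans h'.2.1.symm
  · intro i j hij
    rw [Set.disjoint_left]
    intro e
    induction e using Sym2.ind with
    | _ x y =>
      rintro (⟨h, hc⟩ | ⟨h, hc⟩) (⟨h', hc'⟩ | ⟨h', hc'⟩)
      · exact hij (hc.symm.trans hc')
      · exact absurd (hlev _ _ h) (hlev _ _ h').asymm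
      · exact absurd (hlev _ _ h) (hlev _ _ h').asymm
      · exact hij (hc.symm.trans hc')
  · ext e
    induction e using Sym2.ind with
    | _ x y =>
      rw [Set.mem_iUnion, SimpleGraph.mem_edgeSet, hG]
      constructor
      · rintro ⟨i, h⟩
        exact Or.imp And.left And.left h
      · rintro (h | h)
        · exact ⟨_, Or.inl ⟨h, rfl⟩⟩
        · exact ⟨_, Or.inr ⟨h, rfl⟩⟩

/-! ### Colouring number -/

/-- A graph with at most two downward edges at every vertex has colouring number at most three. -/
theorem colouringNumber_le_three {V : Type u} (G : SimpleGraph V) (D : V → V → Prop)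
    (hG : ∀ x y, G.Adj x y ↔ D x y ∨ D y x) (lev : V → ℕ)
    (hlev : ∀ v w, D v w → lev w < lev v)
    (fst : V → V) (hfst : ∀ v x y, D v x → D v y → x ≠ fst v → y ≠ fst v → x = y) :
    colouringNumber G ≤ 3 := by
  classical
  refine csInf_le' ?_
  let f : V ↪ ℕ × V := ⟨fun v => (lev v, v), fun x y h => (Prod.ext_iff.1 h).2⟩
  -- Order by level, breaking ties by an arbitrary well-order: earlier neighbours are then downward
  -- neighbours.
  refine ⟨f ⁻¹'o Prod.Lex (· < ·) WellOrderingRel, (RelEmbedding.preimage f _).isWellOrder, ?_⟩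
  intro v
  have hD : ∀ w, (f ⁻¹'o Prod.Lex (· < ·) WellOrderingRel) w v → G.Adj v w → D v w := by
    intro w hr hadj
    rcases (hG v w).1 hadj with h | h
    · exact h
    · have h1 := hlev _ _ h
      rcases Prod.lex_def.1 hr with h2 | h2
      · exact absurd h1 h2.asymm
      · exact absurd h2.1.symm h1.ne
  have h2 : #{w : V // (f ⁻¹'o Prod.Lex (· < ·) WellOrderingRel) w v ∧ G.Adj v w} ≤ 2 := by
    have h3 : #(ULift.{u} Bool) = 2 := by simp
    rw [← h3]
    refine mk_le_of_injective (f := fun w => ULift.up (decide (w.1 = fst v))) ?_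
    rintro ⟨x, hx⟩ ⟨y, hy⟩ h
    have h' : x = fst v ↔ y = fst v := decide_eq_decide.1 (ULift.up.inj h)
    refine Subtype.ext (?_ : x = y)
    by_cases hxf : x = fst v
    · exact hxf.trans (h'.1 hxf).symm
    · exact hfst v x y (hD x hx.1 hx.2) (hD y hy.1 hy.2) hxf (fun hyf => hxf (h'.2 hyf))
  exact h2.trans_lt (by exact_mod_cast (by norm_num : (2 : ℕ) < 3))

/-- A graph containing a triangle has colouring number at least three. -/
theorem three_le_colouringNumber {V : Type u} (G : SimpleGraph V) {x y z : V}
    (hxy : G.Adj x y) (hxz : G.Adj x z) (hyz : G.Adj y z) : 3 ≤ colouringNumber G := by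
  refine le_csInf ?_ ?_
  · exact ⟨Order.succ #V, WellOrderingRel, inferInstance,
      fun v => Order.lt_succ_iff.2 (mk_subtype_le _)⟩
  · rintro μ ⟨r, hr, h⟩
    -- The last vertex of the triangle has the other two before it.
    have key : ∀ u v w : V, r u w → r v w → u ≠ v → G.Adj w u → G.Adj w v → 3 ≤ μ := by
      intro u v w hu hv huv hwu hwv
      have h2 : (2 : Cardinal.{u}) ≤ #{t : V // r t w ∧ G.Adj w t} :=
        two_le_iff.2 ⟨⟨u, hu, hwu⟩, ⟨v, hv, hwv⟩, fun e => huv (congrArg Subtype.val e)⟩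
      have h3 : Order.succ (2 : Cardinal.{u}) ≤ μ := Order.succ_le_of_lt (h2.trans_lt (h w))
      have h4 : Order.succ (2 : Cardinal.{u}) = 3 := by
        have := Cardinal.succ_natCast.{u} 2
        norm_num at this
        exact this
      rwa [h4] at h3
    rcases trichotomous_of r x y with h1 | h1 | h1
    · rcases trichotomous_of r y z with h2 | h2 | h2
      · exact key x y z (trans_of r h1 h2) h2 hxy.ne hxz.symm hyz.symm
      · exact absurd h2 hyz.ne
      · exact key x z y h1 h2 hxz.ne hxy.symm hyz
    · exact absurd h1 hxy.ne
    · rcases trichotomous_of r x z with h2 | h2 | h2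
      · exact key x y z h2 (trans_of r h1 h2) hxy.ne hxz.symm hyz.symm
      · exact absurd h2 hxz.ne
      · exact key y z x h1 h2 hyz.ne hxy hxz

/-! ### Edge-connectivity -/

/-- Deleting all edges disconnects a graph with two vertices. -/
theorem not_connected_deleteEdges_edgeSet {V : Type u} [Nontrivial V] (G : SimpleGraph V) :
    ¬ (G.deleteEdges G.edgeSet).Connected := by
  intro hc
  obtain ⟨x, y, hxy⟩ := exists_pair_ne V
  obtain ⟨p⟩ := hc.preconnected x y
  cases p with
  | nil => exact hxy rfl
  | cons h _ =>
    rw [SimpleGraph.deleteEdges_adj] at h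
    exact h.2 h.1

/-- The edge-connectivity of a graph is at most any infinite bound for its number of vertices. -/
theorem edgeConnectivity_le {V : Type u} [Nontrivial V] (G : SimpleGraph V) {κ : Cardinal.{u}}
    (hκ : ℵ₀ ≤ κ) (hV : #V ≤ κ) : edgeConnectivity G ≤ κ := by
  have hmem : edgeConnectivity G ≤ #G.edgeSet :=
    csInf_le' ⟨G.edgeSet, subset_rfl, not_connected_deleteEdges_edgeSet G, rfl⟩
  have h1 : #G.edgeSet ≤ #(Sym2 V) := mk_set_le _
  have h2 : #(Sym2 V) ≤ #(V × V) := mk_le_of_surjective Sym2.mk_surjective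
  refine hmem.trans (h1.trans (h2.trans ?_))
  rw [mk_prod, lift_id]
  exact (mul_le_mul' hV hV).trans (mul_eq_self hκ).le

/-- If any two distinct vertices are joined by `κ` many paths of length two, then disconnecting the
graph takes at least `κ` edges. -/
theorem le_edgeConnectivity {V K : Type u} [Nontrivial V] (G : SimpleGraph V)
    (h : ∀ x y : V, x ≠ y → ∃ m : K → V, Function.Injective m ∧
      ∀ k, G.Adj x (m k) ∧ G.Adj (m k) y) : #K ≤ edgeConnectivity G := by
  refine le_csInf ?_ ?_
  · exact ⟨_, G.edgeSet, subset_rfl, not_connected_deleteEdges_edgeSet G, rfl⟩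
  · rintro μ ⟨F, -, hF, rfl⟩
    by_contra hlt
    rw [not_le] at hlt
    refine hF ⟨fun x y => ?_⟩
    by_cases hxy : x = y
    · subst hxy; exact SimpleGraph.Reachable.refl _
    obtain ⟨m, hm, hadj⟩ := h x y hxy
    by_cases hk : ∃ k, s(x, m k) ∉ F ∧ s(m k, y) ∉ F
    · obtain ⟨k, h1, h2⟩ := hk
      have e1 : (G.deleteEdges F).Adj x (m k) :=
        SimpleGraph.deleteEdges_adj.2 ⟨(hadj k).1, h1⟩
      have e2 : (G.deleteEdges F).Adj (m k) y :=
        SimpleGraph.deleteEdges_adj.2 ⟨(hadj k).2, h2⟩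
      exact e1.reachable.trans e2.reachable
    · exfalso
      -- Otherwise `F` meets every path. The edge it hits determines the middle vertex, so `F` has
      -- at least `#K` elements.
      have hall : ∀ k, ∃ e : F, m k ∈ e.1 ∧ (e.1 = s(x, m k) ∨ e.1 = s(m k, y)) := by
        intro k
        by_cases h1 : s(x, m k) ∈ F
        · exact ⟨⟨_, h1⟩, Sym2.mem_mk_right _ _, Or.inl rfl⟩
        · have h2 : s(m k, y) ∈ F := by
            by_contra h2
            exact hk ⟨k, h1, h2⟩
          exact ⟨⟨_, h2⟩, Sym2.mem_mk_left _ _, Or.inr rfl⟩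
      choose g hg using hall
      refine absurd (mk_le_of_injective (f := g) ?_) (not_le.2 hlt)
      intro k k' hkk
      have h1 := (hg k).1
      rw [hkk] at h1
      rcases (hg k').2 with h2 | h2 <;> rw [h2, Sym2.mem_iff] at h1
      · exact hm (h1.resolve_left (hadj k).1.ne')
      · exact hm (h1.resolve_right (hadj k).2.ne)

/-! ### The concrete graph -/

/-- The vertices of the iterated two-path graph: two initial ones, and middle vertices `mid n k`
added at step `n + 1`. -/
inductive TwoPathVertex (K : Type u) : Type u
  | left : TwoPathVertex K
  | right : TwoPathVertex K
  | mid (n : ℕ) (k : K) : TwoPathVertex K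

namespace TwoPathVertex

variable {K : Type u}

/-- The level of a vertex. -/
def level : TwoPathVertex K → ℕ
  | left => 0
  | right => 1
  | mid n _ => n + 2

/-- The vertices present after `n` steps. -/
def stage (K : Type u) (n : ℕ) : Set (TwoPathVertex K) := {v | v.level ≤ n + 1}

instance : Nontrivial (TwoPathVertex K) := ⟨left, right, by simp⟩

theorem mk_le (hK : ℵ₀ ≤ #K) : #(TwoPathVertex K) ≤ #K := by
  let f : TwoPathVertex K → Option (Option (ℕ × K)) := fun v =>
    match v with
    | left => none
    | right => some none
    | mid n k => some (some (n, k))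
  have hf : Function.Injective f := by
    rintro (_ | _ | _) (_ | _ | _) h <;> simp_all [f]
  refine (mk_le_of_injective hf).trans ?_
  rw [mk_option, mk_option, mk_prod, mk_nat, lift_aleph0, lift_uzero, aleph0_mul_eq hK,
    add_one_eq hK, add_one_eq hK]

/-- This count allows `K` alone to index the middle vertices of every step. -/
theorem mk_distinctPairs_prod (hK : ℵ₀ ≤ #K) (n : ℕ) : #(DistinctPairs (stage K n) × K) = #K := by
  rw [mk_prod, lift_id, lift_id]
  have hne : Nonempty (DistinctPairs (stage K n)) :=
    ⟨⟨s(left, right), by simp, by simp [stage, level]⟩⟩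
  have h2 : #(Sym2 (TwoPathVertex K)) ≤ #(TwoPathVertex K × TwoPathVertex K) :=
    mk_le_of_surjective Sym2.mk_surjective
  refine mul_eq_right hK ?_ (mk_ne_zero _)
  refine (mk_subtype_le _).trans (h2.trans ?_)
  rw [mk_prod, lift_id]
  exact (mul_le_mul' (mk_le hK) (mk_le hK)).trans (mul_eq_self hK).le

/-- The relation joining a vertex to the earlier vertices which it is attached to. -/
def Down (e : ∀ n, DistinctPairs (stage K n) × K ≃ K) : TwoPathVertex K → TwoPathVertex K → Prop
  | left, _ => False
  | right, w => w = left
  | mid n k, w => w ∈ ((e n).symm k).1.1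

variable (e : ∀ n, DistinctPairs (stage K n) × K ≃ K)

theorem Down.level_lt {v w : TwoPathVertex K} (h : Down e v w) : w.level < v.level := by
  match v, h with
  | right, h => rw [show w = left from h]; exact Nat.one_pos
  | mid n k, h =>
    have : w.level ≤ n + 1 := ((e n).symm k).1.2.2 w h
    exact Nat.lt_succ_of_le this

theorem exists_fst : ∃ fst : TwoPathVertex K → TwoPathVertex K,
    ∀ v x y, Down e v x → Down e v y → x ≠ fst v → y ≠ fst v → x = y := by
  have : ∀ v, ∃ f, ∀ x y, Down e v x → Down e v y → x ≠ f → y ≠ f → x = y := by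
    intro v
    match v with
    | left => exact ⟨left, fun x y h => h.elim⟩
    | right => exact ⟨left, fun x y h _ h' => absurd h h'⟩
    | mid n k =>
      obtain ⟨f, g, hfg⟩ : ∃ f g, s(f, g) = ((e n).symm k).1.1 :=
        Sym2.ind (f := fun z => ∃ f g, s(f, g) = z) (fun f g => ⟨f, g, rfl⟩) _
      refine ⟨f, fun x y hx hy hxf hyf => ?_⟩
      change x ∈ ((e n).symm k).1.1 at hx
      change y ∈ ((e n).symm k).1.1 at hy
      rw [← hfg, Sym2.mem_iff] at hx hy
      exact (hx.resolve_left hxf).trans (hy.resolve_left hyf).symm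
  choose fst h using this
  exact ⟨fst, h⟩

/-- The iterated two-path graph. -/
def graph : SimpleGraph (TwoPathVertex K) where
  Adj x y := Down e x y ∨ Down e y x
  symm := ⟨fun _ _ h => h.symm⟩
  loopless := ⟨fun _ h => by rcases h with h | h <;> exact lt_irrefl _ (Down.level_lt e h)⟩

theorem down_mid (n : ℕ) (p : DistinctPairs (stage K n) × K) (w : TwoPathVertex K) :
    Down e (mid n (e n p)) w ↔ w ∈ p.1.1 := by
  simp [Down]

/-- The pair of two distinct vertices of a stage. -/
def pair {n : ℕ} {x y : TwoPathVertex K} (hxy : x ≠ y) (hx : x ∈ stage K n) (hy : y ∈ stage K n) :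
    DistinctPairs (stage K n) :=
  ⟨s(x, y), by simpa using hxy, by
    intro z hz
    rcases Sym2.mem_iff.1 hz with rfl | rfl <;> assumption⟩

/-- The stages are induced subgraphs, since each edge appears together with its upper end. -/
theorem graph_isIteratedTwoPathGraph {κ : Cardinal.{u}}
    (e : ∀ n, DistinctPairs (stage κ.out n) × κ.out ≃ κ.out) :
    IsIteratedTwoPathGraph κ (graph e) := by
  refine ⟨fun n => (⊤ : (graph e).Subgraph).induce (stage κ.out n), ?_, ?_, ?_⟩
  · refine ⟨left, right, by simp, ?_, ?_⟩
    · ext v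
      rcases v with _ | _ | _ <;> simp [stage, level]
    · exact ⟨by simp [stage, level], by simp [stage, level], Or.inr rfl⟩
  · intro n
    refine ⟨fun p => mid n (e n p), ?_, ?_, ?_, ?_⟩
    · intro p q h
      exact (e n).injective (mid.inj h).2
    · intro p h
      have : n + 2 ≤ n + 1 := h
      omega
    · ext v
      change v.level ≤ n + 1 + 1 ↔ v.level ≤ n + 1 ∨ v ∈ Set.range _
      constructor
      · intro h
        rcases h.lt_or_eq with h | h
        · exact Or.inl (Nat.le_of_lt_succ h)
        · right
          rcases v with _ | _ | ⟨j, k⟩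
          · simp [level] at h
          · simp [level] at h
          · obtain rfl : j = n := by simpa [level] using h
            exact ⟨(e j).symm k, by simp⟩
      · rintro (h | ⟨p, rfl⟩)
        · omega
        · exact le_rfl
    · have hnew : ∀ x y, Down e x y → x.level ≤ n + 2 →
          (x.level ≤ n + 1) ∨ ∃ p, x = mid n (e n p) ∧ y ∈ p.1.1 := by
        intro x y h hx
        rcases hx.lt_or_eq with hx | hx
        · exact Or.inl (Nat.le_of_lt_succ hx)
        · right
          rcases x with _ | _ | ⟨j, k⟩
          · simp [level] at hx
          · simp [level] at hx
          · obtain rfl : j = n := by simpa [level] using hx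
            exact ⟨(e j).symm k, by simp, h⟩
      intro x y
      change (x.level ≤ n + 1 + 1 ∧ y.level ≤ n + 1 + 1 ∧ (Down e x y ∨ Down e y x)) ↔
        (x.level ≤ n + 1 ∧ y.level ≤ n + 1 ∧ (Down e x y ∨ Down e y x)) ∨ _
      constructor
      · rintro ⟨hx, hy, h | h⟩
        · rcases hnew x y h hx with h' | h'
          · exact Or.inl ⟨h', (Down.level_lt e h).le.trans h', Or.inl h⟩
          · exact Or.inr (Or.inl h')
        · rcases hnew y x h hy with h' | h'
          · exact Or.inl ⟨(Down.level_lt e h).le.trans h', h', Or.inr h⟩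
          · exact Or.inr (Or.inr h')
      · rintro (⟨hx, hy, h⟩ | ⟨p, rfl, h⟩ | ⟨p, rfl, h⟩)
        · exact ⟨by omega, by omega, h⟩
        · have : y.level ≤ n + 1 := p.1.2.2 y h
          exact ⟨le_rfl, by omega, Or.inl ((down_mid e n p y).2 h)⟩
        · have : x.level ≤ n + 1 := p.1.2.2 x h
          exact ⟨by omega, le_rfl, Or.inr ((down_mid e n p x).2 h)⟩
  · ext x y
    · simp only [SimpleGraph.Subgraph.verts_iSup, SimpleGraph.Subgraph.induce_verts,
        SimpleGraph.Subgraph.verts_top, Set.mem_iUnion, Set.mem_univ, iff_true]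
      exact ⟨x.level, Nat.le_succ _⟩
    · simp only [SimpleGraph.Subgraph.iSup_adj, SimpleGraph.Subgraph.induce_adj,
        SimpleGraph.Subgraph.top_adj]
      constructor
      · rintro ⟨_, _, _, h⟩
        exact h
      · intro h
        refine ⟨x.level + y.level, ?_, ?_, h⟩
        · change x.level ≤ _
          omega
        · change y.level ≤ _
          omega

theorem graph_hasDecomposition {ι : Type u} (f : ι ↪ K) {i₀ i₁ : ι} (hi : i₀ ≠ i₁) :
    HasDecomposition (graph e) #ι := by
  classical
  obtain ⟨fst, hfst⟩ := exists_fst e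
  -- The connectors of `w` are middle vertices for the pair `left`, `w`, added right after stage
  -- `w.level`, which contains both. The value at `left` is junk.
  let s : TwoPathVertex K → ι → TwoPathVertex K := fun w i =>
    if h : w = left then left else
      mid w.level (e w.level (pair (Ne.symm h) (Nat.zero_le _) (Nat.le_succ _), f i))
  have hs : ∀ w i (h : w ≠ left), s w i =
      mid w.level (e w.level (pair (Ne.symm h) (Nat.zero_le _) (Nat.le_succ _), f i)) :=
    fun w i h => dif_neg h
  refine hasDecomposition_of_downward (graph e) (Down e) (fun _ _ => Iff.rfl) level
    (fun _ _ => Down.level_lt e) left (fun _ h => h) s ?_ ?_ fst hfst hi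
  · intro w i hw x
    rw [hs w i hw, down_mid]
    exact Sym2.mem_iff
  · intro w w' i i' hw hw' h
    have hf : ∀ x, x = left ∨ x = w ↔ x = left ∨ x = w' := by
      intro x
      have h1 : Down e (s w i) x ↔ Down e (s w' i') x := by rw [h]
      rw [hs w i hw, hs w' i' hw', down_mid, down_mid] at h1
      exact Sym2.mem_iff.symm.trans (h1.trans Sym2.mem_iff)
    obtain rfl : w = w' := ((hf w).1 (Or.inr rfl)).resolve_left hw
    rw [hs w i hw, hs w i' hw] at h
    exact ⟨rfl, f.injective (Prod.ext_iff.1 ((e _).injective (mid.inj h).2)).2⟩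

theorem colouringNumber_graph [Nonempty K] : colouringNumber (graph e) = 3 := by
  obtain ⟨fst, hfst⟩ := exists_fst e
  refine le_antisymm (colouringNumber_le_three (graph e) (Down e) (fun _ _ => Iff.rfl) level
    (fun _ _ => Down.level_lt e) fst hfst) ?_
  obtain ⟨k⟩ := ‹Nonempty K›
  let p : DistinctPairs (stage K 0) :=
    pair (x := left) (y := right) (by simp) (Nat.zero_le _)
      (show (1 : ℕ) ≤ 0 + 1 from le_rfl)
  exact three_le_colouringNumber (graph e) (x := left) (y := right) (z := mid 0 (e 0 (p, k)))
    (Or.inr rfl) (Or.inr ((down_mid e 0 (p, k) _).2 (Sym2.mem_mk_left _ _)))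
    (Or.inr ((down_mid e 0 (p, k) _).2 (Sym2.mem_mk_right _ _)))

theorem edgeConnectivity_graph (hK : ℵ₀ ≤ #K) : edgeConnectivity (graph e) = #K := by
  refine le_antisymm (edgeConnectivity_le _ hK (mk_le hK)) (le_edgeConnectivity _ ?_)
  intro x y hxy
  -- A stage late enough to contain both vertices.
  let n := x.level + y.level
  have hx : x.level ≤ n + 1 := by omega
  have hy : y.level ≤ n + 1 := by omega
  refine ⟨fun k => mid n (e n (pair hxy hx hy, k)), ?_, ?_⟩
  · intro k k' h
    exact (Prod.ext_iff.1 ((e n).injective (mid.inj h).2)).2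
  · intro k
    exact ⟨Or.inr ((down_mid e n _ _).2 (Sym2.mem_mk_left _ _)),
      Or.inl ((down_mid e n _ _).2 (Sym2.mem_mk_right _ _))⟩

end TwoPathVertex

theorem mainTheorem3 (κ : Cardinal.{u}) (hκ : ℵ₀ ≤ κ) :
    ∃ (V : Type u) (G : SimpleGraph V),
      IsIteratedTwoPathGraph κ G ∧
      (∀ μ : Cardinal.{u}, 2 ≤ μ → μ ≤ κ → HasDecomposition G μ) ∧
      colouringNumber G = 3 ∧
      edgeConnectivity G = κ := by
  have hK : ℵ₀ ≤ #κ.out := by rwa [mk_out]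
  have : Nonempty κ.out := mk_ne_zero_iff.1 (aleph0_pos.trans_le hK).ne'
  have e : ∀ n, DistinctPairs (TwoPathVertex.stage κ.out n) × κ.out ≃ κ.out := fun n =>
    (Cardinal.eq.1 (TwoPathVertex.mk_distinctPairs_prod hK n)).some
  refine ⟨TwoPathVertex κ.out, TwoPathVertex.graph e,
    TwoPathVertex.graph_isIteratedTwoPathGraph e, ?_, TwoPathVertex.colouringNumber_graph e,
    (TwoPathVertex.edgeConnectivity_graph e hK).trans (mk_out κ)⟩
  intro μ h2 hμ
  obtain ⟨i₀, i₁, hi⟩ := two_le_iff.1 (h2.trans (mk_out μ).ge)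
  obtain ⟨f⟩ : Nonempty (μ.out ↪ κ.out) := by rwa [← Cardinal.le_def, mk_out, mk_out]
  have := TwoPathVertex.graph_hasDecomposition e f hi
  rwa [mk_out] at this
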